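/- Let $d$ be a positive integer, let $\langle z,w\rangle=\sum_{i=1}^d z_i\overline{w_i}$ and $|z|^2=\langle z,z\rangle$ on $\mathbb C^d$, and let $\mathcal F^2(\mathbb C^d)$ be the Fock space, i.e. the Hilbert space of all entire functions $f$ on $\mathbb C^d$ with $\|f\|^2=\pi^{-d}\int_{\mathbb C^d}|f(z)|^2e^{-|z|^2}\,dV(z)<\infty$, with the inner product $\langle f,g\rangle=\pi^{-d}\int_{\mathbb C^d}f(z)\overline{g(z)}e^{-|z|^2}\,dV(z)$, where $dV$ is Lebesgue measure. For an entire function $\psi$ on $\mathbb C^d$ and a holomorphic map $\varphi:\mathbb C^d\to\mathbb C^d$, let $C_{\psi,\varphi,\max}$ be the maximal weighted composition operator on $\mathcal F^2(\mathbb C^d)$: its domain is $\{f\in\mathcal F^2(\mathbb C^d):\psi\cdot(f\circ\varphi)\in\mathcal F^2(\mathbb C^d)\}$, and $C_{\psi,\varphi,\max}f=\psi\cdot(f\circ\varphi)$ for $f$ in this domain. Let $A$ be a diagonal complex $d\times d$ matrix, let $\beta,\lambda\in\mathbb C^d$ and $\theta\in\mathbb C$, and put $$\psi(z)=\theta e^{\langle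 z,\overline\lambda\rangle},\quad \varphi(z)=Az+\beta,\qquad \widehat\psi(z)=\overline\theta e^{\langle z,\beta\rangle},\quad \widehat\varphi(z)=\overline A z+\overline\lambda,$$ where bars on matrices and vectors denote entrywise complex conjugation. Then $C_{\psi,\varphi,\max}$ is densely defined, and its adjoint, as an unbounded operator, is $$C_{\psi,\varphi,\max}^*=C_{\widehat\psi,\widehat\varphi,\max}$$ (equality of the domains and of the values). -/

import Mathlib

open MeasureTheory Filter Topology
open scoped ENNReal

noncomputable section

/-! ### The Fock space -/

/-- The Gaussian measure `π⁻ᵈ e^{-|z|²} dV(z)` on `ℂᵈ`, where `dV` is Lebesgue measure and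
`|z|² = ∑ i, |z i|²` is the Euclidean norm squared (the sup norm of `Fin d → ℂ` is not used). -/
def fockMeasure (d : ℕ) : Measure (Fin d → ℂ) :=
  (volume : Measure (Fin d → ℂ)).withDensity
    fun z => ENNReal.ofReal ((Real.pi ^ d)⁻¹ * Real.exp (-∑ i, ‖z i‖ ^ 2))

/-- The entire functions on `ℂᵈ` that are square integrable for the Gaussian measure, as a linear
subspace of the space of all functions. -/
def fockSubmodule (d : ℕ) : Submodule ℂ ((Fin d → ℂ) → ℂ) where
  carrier := {f | Differentiable ℂ f ∧ MemLp f 2 (fockMeasure d)}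
  zero_mem' := ⟨differentiable_const 0, MemLp.zero⟩
  add_mem' hf hg := ⟨hf.1.add hg.1, hf.2.add hg.2⟩
  smul_mem' c _ hf := ⟨hf.1.const_smul c, hf.2.const_smul c⟩

/-- The Fock space on `ℂᵈ`. (A type of its own, so that it carries the topology of the Fock norm
and not that of pointwise convergence.) -/
def FockSpace (d : ℕ) : Type := fockSubmodule d

namespace FockSpace

variable {d : ℕ}

instance : AddCommGroup (FockSpace d) := inferInstanceAs (AddCommGroup (fockSubmodule d))
instance : Module ℂ (FockSpace d) := inferInstanceAs (Module ℂ (fockSubmodule d))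

/-- The inclusion of the Fock space in the space of all functions on `ℂᵈ`. -/
def toFun : FockSpace d →ₗ[ℂ] ((Fin d → ℂ) → ℂ) := (fockSubmodule d).subtype

instance : CoeFun (FockSpace d) fun _ => (Fin d → ℂ) → ℂ := ⟨fun f => toFun f⟩

theorem differentiable (f : FockSpace d) : Differentiable ℂ f := f.2.1

theorem memLp (f : FockSpace d) : MemLp f 2 (fockMeasure d) := f.2.2

theorem toFun_injective : Function.Injective (toFun : FockSpace d → (Fin d → ℂ) → ℂ) :=
  Subtype.val_injective

/-- The map that sends a function of the Fock space to its class in `L²` of the Gaussian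
measure. -/
def toL2 : FockSpace d →ₗ[ℂ] Lp ℂ 2 (fockMeasure d) where
  toFun f := f.memLp.toLp f
  map_add' f g := MemLp.toLp_add f.memLp g.memLp
  map_smul' c f := MemLp.toLp_const_smul c f.memLp

theorem measurable_density : Measurable fun z : Fin d → ℂ =>
    ENNReal.ofReal ((Real.pi ^ d)⁻¹ * Real.exp (-∑ i, ‖z i‖ ^ 2)) := by
  refine (ENNReal.continuous_ofReal.comp ?_).measurable
  fun_prop

theorem volume_absolutelyContinuous :
    (volume : Measure (Fin d → ℂ)) ≪ fockMeasure d := by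
  refine withDensity_absolutelyContinuous' measurable_density.aemeasurable (ae_of_all _ fun z => ?_)
  have : 0 < (Real.pi ^ d)⁻¹ * Real.exp (-∑ i, ‖z i‖ ^ 2) := by positivity
  simpa using this

theorem toL2_injective : Function.Injective (toL2 : FockSpace d → Lp ℂ 2 (fockMeasure d)) := by
  intro f g h
  have h1 : toFun f =ᵐ[fockMeasure d] toFun g := (MemLp.toLp_eq_toLp_iff f.memLp g.memLp).1 h
  exact toFun_injective (Measure.eq_of_ae_eq (volume_absolutelyContinuous.ae_le h1)
    f.differentiable.continuous g.differentiable.continuous)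

/-- The Fock norm is the norm of `L²` of the Gaussian measure. -/
instance : NormedAddCommGroup (FockSpace d) :=
  NormedAddCommGroup.induced (FockSpace d) (Lp ℂ 2 (fockMeasure d)) toL2 toL2_injective

/-- The Fock inner product is that of `L²` of the Gaussian measure; `inner ℂ f g`, which is linear
in its second argument `g`, is `π⁻ᵈ ∫ g(z) conj(f(z)) e^{-|z|²} dV(z)` (see `inner_eq`). -/
instance : InnerProductSpace ℂ (FockSpace d) := InnerProductSpace.induced toL2

theorem inner_eq (f g : FockSpace d) :
    inner ℂ f g = ((Real.pi ^ d)⁻¹ : ℝ) •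
      ∫ z : Fin d → ℂ, g z * (starRingEnd ℂ) (f z) * (Real.exp (-∑ i, ‖z i‖ ^ 2) : ℝ) := by
  have h1 : inner ℂ f g = ∫ z, g z * (starRingEnd ℂ) (f z) ∂(fockMeasure d) := by
    change inner ℂ (toL2 f) (toL2 g) = _
    rw [L2.inner_def]
    refine integral_congr_ae ?_
    filter_upwards [f.memLp.coeFn_toLp, g.memLp.coeFn_toLp] with z hf hg
    change inner ℂ ((f.memLp.toLp f : Lp ℂ 2 (fockMeasure d)) z)
      ((g.memLp.toLp g : Lp ℂ 2 (fockMeasure d)) z) = _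
    rw [hf, hg]
    rfl
  rw [h1, fockMeasure, integral_withDensity_eq_integral_toReal_smul measurable_density
    (ae_of_all _ fun z => ENNReal.ofReal_lt_top), ← integral_smul]
  refine integral_congr_ae (ae_of_all _ fun z => ?_)
  have : 0 ≤ (Real.pi ^ d)⁻¹ * Real.exp (-∑ i, ‖z i‖ ^ 2) := by positivity
  simp only [ENNReal.toReal_ofReal this, Complex.real_smul]
  push_cast
  ring

/-! ### Completeness of the Fock space -/

theorem rotate_measurePreserving (t : ℝ) :
    MeasurePreserving (fun z : Fin d → ℂ => fun i => rotation (Circle.exp t) (z i)) := by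
  refine volume_preserving_pi (fun _ => ?_)
  exact LinearIsometryEquiv.measurePreserving _

/-- The mean value property on polydiscs. -/
theorem mean_value {f : (Fin d → ℂ) → ℂ} (hf : Differentiable ℂ f) (a : Fin d → ℂ) :
    (volume : Measure (Fin d → ℂ)).real (Metric.closedBall 0 1) • f a
      = ∫ z in Metric.closedBall (0 : Fin d → ℂ) 1, f (a + z) := by
  set B := Metric.closedBall (0 : Fin d → ℂ) 1 with hB
  have hrot : ∀ t : ℝ, ∫ z in B, f (a + Complex.exp (t * Complex.I) • z)
      = ∫ z in B, f (a + z) := by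
    intro t
    set e : (Fin d → ℂ) ≃ᵐ (Fin d → ℂ) := MeasurableEquiv.piCongrRight
      fun _ => (rotation (Circle.exp t)).toHomeomorph.toMeasurableEquiv with he
    have hmp : MeasurePreserving e := rotate_measurePreserving t
    have hez : ∀ z, e z = Complex.exp (t * Complex.I) • z := by
      intro z
      ext i
      change rotation (Circle.exp t) (z i) = _
      simp [rotation_apply]
    have := hmp.setIntegral_preimage_emb e.measurableEmbedding (fun z => f (a + z)) B
    rw [← this]
    have hpre : e ⁻¹' B = B := by
      ext z
      simp [hB, hez, norm_smul, Complex.norm_exp_ofReal_mul_I]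
    rw [hpre]
    simp [hez]
  have hcirc : ∀ z : Fin d → ℂ,
      ∫ t in (0 : ℝ)..2 * Real.pi, f (a + Complex.exp (t * Complex.I) • z)
        = (2 * Real.pi : ℝ) • f a := by
    intro z
    have hd : Differentiable ℂ fun w : ℂ => f (a + w • z) := by fun_prop
    have := hd.diffContOnCl.circleAverage (c := 0) (R := 1)
    rw [Real.circleAverage_def] at this
    simp only [circleMap, zero_add, Complex.ofReal_one, one_mul, zero_smul, add_zero] at this
    rw [← this, smul_smul, mul_inv_cancel₀ (by positivity), one_smul]
  have hcont : Continuous (Function.uncurry fun (t : ℝ) (z : Fin d → ℂ) =>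
      f (a + Complex.exp (t * Complex.I) • z)) := by
    have := hf.continuous
    fun_prop
  have hswap := intervalIntegral_integral_swap (a := 0) (b := 2 * Real.pi)
    (μ := (volume : Measure (Fin d → ℂ)).restrict B)
    (f := fun (t : ℝ) (z : Fin d → ℂ) => f (a + Complex.exp (t * Complex.I) • z)) (by
      rw [Measure.prod_restrict]
      refine IntegrableOn.mono_set (t := Set.uIcc 0 (2 * Real.pi) ×ˢ B) ?_
        (Set.prod_mono Set.uIoc_subset_uIcc subset_rfl)
      exact hcont.continuousOn.integrableOn_compact
        (isCompact_uIcc.prod (isCompact_closedBall _ _)))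
  simp only [hrot, hcirc] at hswap
  rw [intervalIntegral.integral_const, setIntegral_const, sub_zero, smul_comm] at hswap
  exact (smul_right_injective ℂ (by positivity : (2 * Real.pi : ℝ) ≠ 0) hswap).symm

/-- Point evaluations are bounded, uniformly on bounded sets. -/
theorem exists_bound (d : ℕ) (R : ℝ) : ∃ C : ℝ, 0 ≤ C ∧ ∀ (f : FockSpace d) (a : Fin d → ℂ),
    ‖a‖ ≤ R → ‖f a‖ ≤ C * ‖f‖ := by
  set B := Metric.closedBall (0 : Fin d → ℂ) 1 with hB
  set K := Metric.closedBall (0 : Fin d → ℂ) (R + 1) with hK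
  set c : ℝ := (Real.pi ^ d)⁻¹ * Real.exp (-∑ _i : Fin d, (R + 1) ^ 2) with hc
  have hc0 : 0 < c := by positivity
  set c' : ℝ≥0∞ := ENNReal.ofReal c with hc'
  have hc'0 : c' ≠ 0 := by simpa [hc'] using hc0
  have hc't : c' ≠ ∞ := ENNReal.ofReal_ne_top
  have hmeas : (volume : Measure (Fin d → ℂ)).restrict K ≤ c'⁻¹ • fockMeasure d := by
    refine Measure.le_iff.2 fun s hs => ?_
    rw [Measure.restrict_apply hs, Measure.smul_apply, smul_eq_mul]
    rw [← ENNReal.div_eq_inv_mul, ENNReal.le_div_iff_mul_le (Or.inl hc'0) (Or.inl hc't)]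
    have hsK : MeasurableSet (s ∩ K) := hs.inter Metric.isClosed_closedBall.measurableSet
    calc volume (s ∩ K) * c' = ∫⁻ _ in s ∩ K, c' := by
          rw [setLIntegral_const, mul_comm]
      _ ≤ ∫⁻ z in s ∩ K, ENNReal.ofReal ((Real.pi ^ d)⁻¹ * Real.exp (-∑ i, ‖z i‖ ^ 2)) := by
          refine setLIntegral_mono measurable_density fun z hz => ENNReal.ofReal_le_ofReal ?_
          have hz' : ‖z‖ ≤ R + 1 := by simpa [hK] using hz.2
          have : ∀ i, ‖z i‖ ≤ R + 1 := fun i => (norm_le_pi_norm z i).trans hz'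
          simp only [hc]
          gcongr with i
          exact this i
      _ = fockMeasure d (s ∩ K) := by rw [fockMeasure, withDensity_apply _ hsK]
      _ ≤ fockMeasure d s := measure_mono Set.inter_subset_left
  have hvB : 0 < (volume : Measure (Fin d → ℂ)).real B := by
    refine ENNReal.toReal_pos ?_ (isCompact_closedBall _ _).measure_lt_top.ne
    exact (Metric.measure_closedBall_pos _ _ one_pos).ne'
  set M : ℝ≥0∞ := (c'⁻¹) ^ (1 / (2 : ℝ≥0∞)).toReal
    * ((volume : Measure (Fin d → ℂ)).restrict K) Set.univ
      ^ (1 / (1 : ℝ≥0∞).toReal - 1 / (2 : ℝ≥0∞).toReal) with hM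
  have hMt : M ≠ ∞ := by
    refine ENNReal.mul_ne_top (ENNReal.rpow_ne_top_of_nonneg (by positivity) (by simpa using hc'0)) ?_
    refine ENNReal.rpow_ne_top_of_nonneg (by norm_num) ?_
    rw [Measure.restrict_apply_univ]
    exact (isCompact_closedBall _ _).measure_lt_top.ne
  refine ⟨((volume : Measure (Fin d → ℂ)).real B)⁻¹ * M.toReal, by positivity, fun f a ha => ?_⟩
  have hfc : Continuous (f : (Fin d → ℂ) → ℂ) := f.differentiable.continuous
  have hnorm : ‖f‖ = (eLpNorm f 2 (fockMeasure d)).toReal := by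
    change ‖toL2 f‖ = _
    exact Lp.norm_toLp _ f.memLp
  have hL1 : eLpNorm f 1 ((volume : Measure (Fin d → ℂ)).restrict K)
      ≤ M * eLpNorm f 2 (fockMeasure d) := by
    refine (eLpNorm_le_eLpNorm_mul_rpow_measure_univ (p := 1) (q := 2) (by norm_num)
      hfc.aestronglyMeasurable).trans ?_
    have := (eLpNorm_mono_measure (p := 2) (f : (Fin d → ℂ) → ℂ) hmeas)
    rw [eLpNorm_smul_measure_of_ne_top (by norm_num), smul_eq_mul] at this
    rw [hM, mul_right_comm]
    gcongr
  have hint : ∫ z in B, ‖f (a + z)‖ ≤ M.toReal * ‖f‖ := by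
    have h1 : ∫ z in B, ‖f (a + z)‖ = ∫ z in Metric.closedBall a 1, ‖f z‖ := by
      have hmp : MeasurePreserving (fun z : Fin d → ℂ => a + z) := measurePreserving_add_left _ a
      rw [← hmp.setIntegral_preimage_emb (measurableEmbedding_addLeft a)
        (fun z => ‖f z‖) (Metric.closedBall a 1)]
      congr 2
      ext z
      simp [hB]
    have h2 : ∫ z in Metric.closedBall a 1, ‖f z‖ ≤ ∫ z in K, ‖f z‖ := by
      refine setIntegral_mono_set ?_ (ae_of_all _ fun z => norm_nonneg _) ?_
      · exact hfc.norm.continuousOn.integrableOn_compact (isCompact_closedBall _ _)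
      · refine LE.le.eventuallyLE (Metric.closedBall_subset_closedBall' ?_)
        rw [dist_zero_right]
        linarith
    have h3 : ∫ z in K, ‖f z‖
        = (eLpNorm f 1 ((volume : Measure (Fin d → ℂ)).restrict K)).toReal := by
      rw [eLpNorm_one_eq_lintegral_enorm, integral_norm_eq_lintegral_enorm hfc.aestronglyMeasurable]
    rw [h1, hnorm, ← ENNReal.toReal_mul]
    refine h2.trans (h3.le.trans (ENNReal.toReal_mono ?_ hL1))
    exact ENNReal.mul_ne_top hMt f.memLp.eLpNorm_ne_top
  have hmv := congrArg norm (mean_value f.differentiable a)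
  rw [norm_smul, Real.norm_of_nonneg measureReal_nonneg] at hmv
  have h4 := (hmv.le.trans (norm_integral_le_integral_norm _)).trans hint
  rw [mul_assoc, inv_mul_eq_div, le_div_iff₀ hvB, mul_comm]
  exact h4

/-- The derivative of a Fock function is bounded by its norm, uniformly on bounded sets. -/
theorem exists_bound_fderiv (d : ℕ) (R : ℝ) : ∃ C : ℝ, 0 ≤ C ∧
    ∀ (f : FockSpace d) (a : Fin d → ℂ), ‖a‖ ≤ R → ‖fderiv ℂ f a‖ ≤ C * ‖f‖ := by
  obtain ⟨C, hC, h⟩ := exists_bound d (R + 1)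
  refine ⟨C, hC, fun f a ha => ?_⟩
  refine ContinuousLinearMap.opNorm_le_of_unit_norm (by positivity) fun v hv => ?_
  have hd : Differentiable ℂ fun w : ℂ => f (a + w • v) := by
    have := f.differentiable
    fun_prop
  have hder : deriv (fun w : ℂ => f (a + w • v)) 0 = fderiv ℂ f a v :=
    f.differentiable a |>.lineDeriv_eq_fderiv
  rw [← hder]
  refine (Complex.norm_deriv_le_of_forall_mem_sphere_norm_le one_pos hd.diffContOnCl
    (C := C * ‖f‖) fun w hw => h f _ ?_).trans (by simp)
  have hw' : ‖w‖ = 1 := by simpa using hw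
  refine (norm_add_le _ _).trans ?_
  rw [norm_smul, hw', hv]
  linarith

instance : CompleteSpace (FockSpace d) := by
  refine Metric.complete_of_cauchySeq_tendsto fun u hu => ?_
  have hucs : ∀ {E : Type} [NormedAddCommGroup E] (F : ℕ → (Fin d → ℂ) → E) (s : Set (Fin d → ℂ))
      (C : ℝ), 0 ≤ C → (∀ n m, ∀ a ∈ s, ‖F n a - F m a‖ ≤ C * ‖u n - u m‖) →
      UniformCauchySeqOn F atTop s := by
    intro E _ F s C hC hF
    rw [Metric.uniformCauchySeqOn_iff]
    intro ε hε
    obtain ⟨N, hN⟩ := Metric.cauchySeq_iff.1 hu (ε / (C + 1)) (by positivity)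
    refine ⟨N, fun m hm n hn a ha => ?_⟩
    rw [dist_eq_norm]
    have h1 := hN m hm n hn
    rw [dist_eq_norm, lt_div_iff₀ (by positivity)] at h1
    refine (hF m n a ha).trans_lt (lt_of_le_of_lt ?_ h1)
    nlinarith [norm_nonneg (u m - u n)]
  have hc : ∀ R : ℝ, UniformCauchySeqOn (fun n => (u n : (Fin d → ℂ) → ℂ)) atTop
      (Metric.ball 0 R) := by
    intro R
    obtain ⟨C, hC, h⟩ := exists_bound d R
    refine hucs _ _ C hC fun n m a ha => ?_
    have := h (u n - u m) a (by simpa using (mem_ball_zero_iff.1 ha).le)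
    simpa using this
  have hc' : ∀ R : ℝ, UniformCauchySeqOn (fun n => fderiv ℂ (u n : (Fin d → ℂ) → ℂ)) atTop
      (Metric.ball 0 R) := by
    intro R
    obtain ⟨C, hC, h⟩ := exists_bound_fderiv d R
    refine hucs _ _ C hC fun n m a ha => ?_
    have h1 := h (u n - u m) a (by simpa using (mem_ball_zero_iff.1 ha).le)
    rw [map_sub, fderiv_sub ((u n).differentiable a) ((u m).differentiable a)] at h1
    exact h1
  have hmem : ∀ a : Fin d → ℂ, a ∈ Metric.ball (0 : Fin d → ℂ) (‖a‖ + 1) := fun a => by simp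
  have hlim : ∀ a, ∃ l, Tendsto (fun n => u n a) atTop (𝓝 l) := fun a =>
    cauchySeq_tendsto_of_complete ((hc (‖a‖ + 1)).cauchySeq (hmem a))
  have hlim' : ∀ a, ∃ l, Tendsto (fun n => fderiv ℂ (u n : (Fin d → ℂ) → ℂ) a) atTop (𝓝 l) :=
    fun a => cauchySeq_tendsto_of_complete ((hc' (‖a‖ + 1)).cauchySeq (hmem a))
  choose g hg using hlim
  choose g' hg' using hlim'
  have hgd : Differentiable ℂ g := fun a =>
    (hasFDerivAt_of_tendstoUniformlyOn (Metric.isOpen_ball (x := 0) (ε := ‖a‖ + 1))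
      ((hc' (‖a‖ + 1)).tendstoUniformlyOn_of_tendsto fun x _ => hg' x)
      (fun n x _ => ((u n).differentiable x).hasFDerivAt) (fun x _ => hg x)
      (hmem a)).differentiableAt
  have huL : CauchySeq fun n => toL2 (u n) := by
    rw [Metric.cauchySeq_iff] at hu ⊢
    exact hu
  obtain ⟨G, hG⟩ := cauchySeq_tendsto_of_complete huL
  obtain ⟨ns, hns, hae⟩ := (tendstoInMeasure_of_tendsto_Lp hG).exists_seq_tendsto_ae
  have hGg : G =ᵐ[fockMeasure d] g := by
    have hall : ∀ᵐ z ∂(fockMeasure d), ∀ n, toL2 (u n) z = u n z :=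
      ae_all_iff.2 fun n => (u n).memLp.coeFn_toLp
    filter_upwards [hae, hall] with z hz hz'
    refine tendsto_nhds_unique hz ?_
    simp only [hz']
    exact (hg z).comp hns.tendsto_atTop
  have hgm : MemLp g 2 (fockMeasure d) := (memLp_congr_ae hGg).1 (Lp.memLp G)
  set h : FockSpace d := ⟨g, hgd, hgm⟩ with hh
  have hhG : toL2 h = G := by
    refine Lp.ext ?_
    exact hgm.coeFn_toLp.trans hGg.symm
  refine ⟨h, ?_⟩
  rw [tendsto_iff_dist_tendsto_zero] at hG ⊢
  rw [← hhG] at hG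
  exact hG

end FockSpace

/-! ### Weighted composition operators -/

/-- The formal weighted composition expression `E_{ψ,φ}(f) = ψ · (f ∘ φ)`. -/
def weightedComp {d : ℕ} (ψ : (Fin d → ℂ) → ℂ) (φ : (Fin d → ℂ) → Fin d → ℂ) :
    ((Fin d → ℂ) → ℂ) →ₗ[ℂ] ((Fin d → ℂ) → ℂ) where
  toFun f := fun z => ψ z * f (φ z)
  map_add' f g := by
    ext z
    simp [mul_add]
  map_smul' c f := by
    ext z
    simp [mul_left_comm]

/-- The maximal weighted composition operator `C_{ψ,φ,max}`, as an unbounded operator on the Fock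
space: its domain consists of all `f` in the Fock space for which `E_{ψ,φ}(f)` is in the Fock
space, and it maps such an `f` to `E_{ψ,φ}(f)`. -/
def maxWeightedComp {d : ℕ} (ψ : (Fin d → ℂ) → ℂ) (φ : (Fin d → ℂ) → Fin d → ℂ) :
    FockSpace d →ₗ.[ℂ] FockSpace d where
  domain := (fockSubmodule d).comap ((weightedComp ψ φ).comp FockSpace.toFun)
  toFun :=
    { toFun := fun f => ⟨weightedComp ψ φ (FockSpace.toFun (f : FockSpace d)), f.2⟩
      map_add' := fun f g => by
        apply FockSpace.toFun_injective
        exact ((weightedComp ψ φ).comp FockSpace.toFun).map_add f g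
      map_smul' := fun c f => by
        apply FockSpace.toFun_injective
        exact ((weightedComp ψ φ).comp FockSpace.toFun).map_smul c f }

/-- The standard inner product `⟨z, w⟩ = ∑ i, z i * conj (w i)` of `ℂᵈ`, linear in the first
argument. -/
def cInner {d : ℕ} (z w : Fin d → ℂ) : ℂ := ∑ i, z i * (starRingEnd ℂ) (w i)

end

section SeveralVariables

variable {E : Type*} [NormedAddCommGroup E] [NormedSpace ℂ E]

theorem deriv_comp_line {h : E → ℂ} (hh : Differentiable ℂ h) (w v : E) (t : ℂ) :
    deriv (fun s : ℂ => h (w + s • v)) t = fderiv ℂ h (w + t • v) v := by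
  have h1 : HasDerivAt (fun s : ℂ => w + s • v) v t := by
    simpa using ((hasDerivAt_id t).smul_const v).const_add w
  exact ((hh _).hasFDerivAt.comp_hasDerivAt t h1).deriv

theorem norm_fderiv_apply_le_of_sphere {h : E → ℂ} (hh : Differentiable ℂ h) (w v : E)
    {C : ℝ} (hC : ∀ s : ℂ, ‖s‖ = 1 → ‖h (w + s • v)‖ ≤ C) : ‖fderiv ℂ h w v‖ ≤ C := by
  have h1 := deriv_comp_line hh w v 0
  rw [zero_smul, add_zero] at h1
  rw [← h1]
  have hd : Differentiable ℂ fun s : ℂ => h (w + s • v) := by fun_prop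
  refine (Complex.norm_deriv_le_of_forall_mem_sphere_norm_le one_pos hd.diffContOnCl
    fun s hs => hC s (by simpa using hs)).trans (by simp)

/-- Directional derivatives of entire functions of several variables are entire. -/
theorem differentiable_fderiv_apply [FiniteDimensional ℂ E] {h : E → ℂ}
    (hh : Differentiable ℂ h) (v : E) : Differentiable ℂ fun w => fderiv ℂ h w v := by
  borelize E
  have : ProperSpace E := FiniteDimensional.proper ℂ E
  have hint : ∀ w, fderiv ℂ h w v = (2 * Real.pi * Complex.I : ℂ)⁻¹ • ∫ θ in (0 : ℝ)..2 * Real.pi,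
      (deriv (circleMap 0 1) θ * ((circleMap 0 1 θ) ^ 2)⁻¹) * h (w + circleMap 0 1 θ • v) := by
    intro w
    have hd : Differentiable ℂ fun s : ℂ => h (w + s • v) := by fun_prop
    have h1 := deriv_comp_line hh w v 0
    rw [zero_smul, add_zero] at h1
    rw [← h1, ← Complex.cderiv_eq_deriv isOpen_univ hd.differentiableOn one_pos
      (Set.subset_univ _), Complex.cderiv, circleIntegral]
    simp only [sub_zero, smul_eq_mul, mul_assoc]
  have hc : Continuous fun θ : ℝ => deriv (circleMap 0 1) θ * ((circleMap 0 1 θ) ^ 2)⁻¹ := by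
    have : ∀ θ : ℝ, (circleMap 0 1 θ) ^ 2 ≠ 0 := fun θ => by
      simp [circleMap]
    simp only [deriv_circleMap]
    fun_prop (disch := simpa using this _)
  have hn : ∀ θ : ℝ, ‖deriv (circleMap 0 1) θ * ((circleMap 0 1 θ) ^ 2)⁻¹‖ = 1 := fun θ => by
    simp [circleMap, deriv_circleMap]
  have hcont := hh.continuous
  intro w₀
  have hfun : (fun w => fderiv ℂ h w v) = fun w => (2 * Real.pi * Complex.I : ℂ)⁻¹ •
      ∫ θ in (0 : ℝ)..2 * Real.pi, (deriv (circleMap 0 1) θ * ((circleMap 0 1 θ) ^ 2)⁻¹) *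
        h (w + circleMap 0 1 θ • v) := funext hint
  rw [hfun]
  obtain ⟨C, hC⟩ := (isCompact_closedBall w₀ (1 + ‖v‖ + 1)).exists_bound_of_continuousOn
    hcont.continuousOn
  refine DifferentiableAt.fun_const_smul (R := ℂ) ?_ _
  refine HasFDerivAt.differentiableAt
    (intervalIntegral.hasFDerivAt_integral_of_dominated_of_fderiv_le (𝕜 := ℂ) (bound := fun _ => C)
      (F' := fun w θ => (deriv (circleMap 0 1) θ * ((circleMap 0 1 θ) ^ 2)⁻¹) •
        fderiv ℂ h (w + circleMap 0 1 θ • v)) (Metric.ball_mem_nhds w₀ one_pos) ?_ ?_ ?_ ?_ ?_ ?_)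
  · refine Eventually.of_forall fun w => Continuous.aestronglyMeasurable ?_
    have := hc
    fun_prop
  · refine Continuous.intervalIntegrable ?_ _ _
    have := hc
    fun_prop
  · refine hc.aestronglyMeasurable.smul ?_
    have hm : Measurable (fderiv ℂ h) := measurable_fderiv ℂ h
    exact (hm.comp (by fun_prop : Continuous fun θ : ℝ =>
      w₀ + circleMap 0 1 θ • v).measurable).aestronglyMeasurable
  · refine ae_of_all _ fun θ _ w hw => ?_
    rw [norm_smul, hn, one_mul]
    have hw' : ‖w - w₀‖ < 1 := by simpa [dist_eq_norm] using hw
    have hC0 : 0 ≤ C := (norm_nonneg _).trans (hC w₀ (by simp; positivity))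
    refine ContinuousLinearMap.opNorm_le_of_unit_norm hC0 fun u hu => ?_
    refine norm_fderiv_apply_le_of_sphere hh _ u fun s hs => hC _ ?_
    rw [mem_closedBall_iff_norm]
    have h1 : w + circleMap 0 1 θ • v + s • u - w₀ = (w - w₀) + circleMap 0 1 θ • v + s • u := by
      abel
    rw [h1]
    refine (norm_add₃_le).trans ?_
    simp only [norm_smul, hs, hu, circleMap, Complex.ofReal_one, zero_add, one_mul,
      Complex.norm_exp_ofReal_mul_I]
    linarith
  · exact intervalIntegrable_const
  · refine ae_of_all _ fun θ _ w _ => ?_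
    have := ((hh (w + circleMap 0 1 θ • v)).hasFDerivAt.comp w
      ((hasFDerivAt_id w).add_const (circleMap 0 1 θ • v)))
    have h2 := this.const_smul (deriv (circleMap 0 1) θ * ((circleMap 0 1 θ) ^ 2)⁻¹)
    simpa using! h2

theorem eq_zero_of_iteratedDeriv_eq_zero {g : ℂ → ℂ} (hg : Differentiable ℂ g) (c : ℂ)
    (h : ∀ n, iteratedDeriv n g c = 0) (z : ℂ) : g z = 0 := by
  rw [← Complex.taylorSeries_eq_of_entire' c z hg]
  simp [h]

/-- An entire function that changes sign under `s ↦ s + 1` and is bounded on a period strip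
vanishes. -/
theorem eq_zero_of_antiperiodic_of_bounded_strip {q : ℂ → ℂ} (hq : Differentiable ℂ q)
    (hanti : Function.Antiperiodic q 1) {M : ℝ}
    (hM : ∀ s : ℂ, 0 ≤ s.re → s.re ≤ 1 → ‖q s‖ ≤ M) (s : ℂ) : q s = 0 := by
  have hper : Function.Periodic (fun s => ‖q s‖) 1 := fun s => by simp [hanti s]
  have hb : Bornology.IsBounded (Set.range q) := by
    rw [isBounded_iff_forall_norm_le]
    refine ⟨M, ?_⟩
    rintro _ ⟨s, rfl⟩
    have h1 := hper.sub_zsmul_eq (x := s) ⌊s.re⌋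
    beta_reduce at h1
    rw [← h1]
    have h2 : (s - ⌊s.re⌋ • (1 : ℂ)).re = Int.fract s.re := by simp
    exact hM _ (h2 ▸ Int.fract_nonneg _) (h2 ▸ (Int.fract_lt_one _).le)
  have h1 := hq.apply_eq_apply_of_bounded hb (s + 1) s
  rw [hanti s] at h1
  linear_combination (-1 / 2 : ℂ) * h1

end SeveralVariables

section FunctionalEquation

open ComplexConjugate

variable {d : ℕ} {U : Finset (Fin d)} {D : Fin d → ℝ} {ν : Fin d → ℂ}

theorem norm_sq_add_mul (w s n : ℂ) :
    ‖w + s * n‖ ^ 2 = ‖w‖ ^ 2 + ‖s‖ ^ 2 * ‖n‖ ^ 2 + 2 * (s * conj (w * conj n)).re := by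
  simp only [← Complex.normSq_eq_norm_sq, Complex.normSq_apply]
  simp
  ring

/-- Vanishing of solutions of the functional equation at the points whose coordinates outside `U`
are fixed by `w ↦ D w + ν`. -/
theorem eq_zero_at_fixed_of_functional_equation (hU : ∀ i ∈ U, D i = 1) (hU' : ∀ i ∉ U, D i ≠ 1)
    {h : (Fin d → ℂ) → ℂ} (hh : Differentiable ℂ h) {c : ℝ} (hc : 0 ≤ c)
    (hfe : ∀ w, h w = -c * Complex.exp (∑ i ∈ U, w i * conj (ν i)) *
      h (fun i => D i * w i + ν i))
    (hgrowth : ∀ R : ℝ, ∃ C : ℝ, ∀ w : Fin d → ℂ, (∀ i ∉ U, ‖w i‖ ≤ R) →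
      ‖h w‖ ≤ C * Real.exp ((∑ i ∈ U, ‖w i‖ ^ 2) / 2))
    {w : Fin d → ℂ} (hw : ∀ i ∉ U, w i = ν i / (1 - D i)) : h w = 0 := by
  rcases hc.eq_or_lt with rfl | hc
  · rw [hfe]; simp
  set n : Fin d → ℂ := fun i => if i ∈ U then ν i else 0 with hn
  set b : ℂ := ∑ i ∈ U, w i * conj (ν i) with hb
  set N : ℝ := ∑ i ∈ U, ‖ν i‖ ^ 2 with hN
  set q : ℂ → ℂ := fun s => h (w + s • n) *
    Complex.exp (s ^ 2 * N / 2 + s * (b - N / 2 + Real.log c)) with hq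
  have hqd : Differentiable ℂ q := by fun_prop
  have hg : ∀ s : ℂ, h (w + s • n) =
      -c * Complex.exp (b + s * N) * h (w + (s + 1) • n) := by
    intro s
    rw [hfe]
    congr 2
    · congr 1
      rw [hb, hN]
      push_cast
      rw [Finset.mul_sum, ← Finset.sum_add_distrib]
      refine Finset.sum_congr rfl fun i hi => ?_
      rw [← Complex.mul_conj']
      simp only [Pi.add_apply, Pi.smul_apply, hn, hi, if_true, smul_eq_mul]
      ring
    · ext i
      by_cases hi : i ∈ U
      · simp only [Pi.add_apply, Pi.smul_apply, hn, hi, if_true, smul_eq_mul, hU i hi]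
        push_cast
        ring
      · have h1 : (1 - D i : ℂ) ≠ 0 := by
          rw [sub_ne_zero]
          exact_mod_cast (hU' i hi).symm
        simp only [Pi.add_apply, Pi.smul_apply, hn, hi, if_false, smul_eq_mul, hw i hi]
        field_simp
        ring
  have hanti : Function.Antiperiodic q 1 := by
    intro s
    simp only [hq]
    rw [hg s]
    have h1 : Complex.exp ((s + 1) ^ 2 * N / 2 + (s + 1) * (b - N / 2 + Real.log c)) =
        c * Complex.exp (b + s * N) *
          Complex.exp (s ^ 2 * N / 2 + s * (b - N / 2 + Real.log c)) := by
      have h2 : (c : ℂ) = Complex.exp (Real.log c : ℝ) := by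
        rw [← Complex.ofReal_exp, Real.exp_log hc]
      nth_rewrite 1 [h2]
      rw [← Complex.exp_add, ← Complex.exp_add]
      congr 1
      ring
    rw [h1]
    ring
  obtain ⟨C, hC⟩ := hgrowth (∑ i, ‖w i‖)
  set W : ℝ := ∑ i ∈ U, ‖w i‖ ^ 2 with hW
  have hstrip : ∀ s : ℂ, 0 ≤ s.re → s.re ≤ 1 →
      ‖q s‖ ≤ |C| * Real.exp (W / 2 + N + |2 * b.re| + |Real.log c|) := by
    intro s hs0 hs1
    have h1 : ‖h (w + s • n)‖ ≤ |C| * Real.exp ((∑ i ∈ U, ‖(w + s • n) i‖ ^ 2) / 2) := by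
      refine (hC _ fun i hi => ?_).trans ?_
      · simp only [Pi.add_apply, Pi.smul_apply, hn, hi, if_false, smul_zero, add_zero]
        exact Finset.single_le_sum (f := fun i => ‖w i‖) (fun _ _ => norm_nonneg _)
          (Finset.mem_univ i)
      · gcongr
        exact le_abs_self C
    have h2 : ∑ i ∈ U, ‖(w + s • n) i‖ ^ 2 = W + ‖s‖ ^ 2 * N + 2 * (s * conj b).re := by
      rw [hW, hN, hb, map_sum, Finset.mul_sum, Finset.mul_sum, Complex.re_sum, Finset.mul_sum,
        ← Finset.sum_add_distrib, ← Finset.sum_add_distrib]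
      refine Finset.sum_congr rfl fun i hi => ?_
      simp only [Pi.add_apply, Pi.smul_apply, hn, hi, if_true, smul_eq_mul]
      exact norm_sq_add_mul _ _ _
    have h3 : (W + ‖s‖ ^ 2 * N + 2 * (s * conj b).re) / 2 +
        (s ^ 2 * N / 2 + s * (b - N / 2 + Real.log c)).re =
        W / 2 + s.re ^ 2 * N + s.re * (2 * b.re) - s.re * N / 2 + s.re * Real.log c := by
      have h4 : (s ^ 2 * N / 2 + s * (b - N / 2 + Real.log c) : ℂ) =
          s ^ 2 * ((N / 2 : ℝ) : ℂ) + s * (b + ((-N / 2 + Real.log c : ℝ) : ℂ)) := by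
        push_cast; ring
      rw [h4, ← Complex.normSq_eq_norm_sq, Complex.normSq_apply]
      simp only [Complex.add_re, Complex.mul_re, Complex.conj_re, Complex.conj_im, pow_two,
        Complex.ofReal_re, Complex.ofReal_im, Complex.add_im, Complex.mul_im]
      ring
    have hN0 : 0 ≤ N := by positivity
    have h5 : ∀ x : ℝ, s.re * x ≤ |x| := fun x =>
      (le_abs_self _).trans (by
        rw [abs_mul, abs_of_nonneg hs0]
        exact mul_le_of_le_one_left (abs_nonneg _) hs1)
    simp only [hq]
    rw [norm_mul, Complex.norm_exp]
    refine (mul_le_mul_of_nonneg_right h1 (Real.exp_nonneg _)).trans ?_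
    rw [mul_assoc, ← Real.exp_add, h2, h3]
    refine mul_le_mul_of_nonneg_left (Real.exp_le_exp.2 ?_) (abs_nonneg _)
    have h6 := h5 (2 * b.re)
    have h7 := h5 (Real.log c)
    have h8 : s.re ^ 2 * N ≤ N := mul_le_of_le_one_left hN0 (pow_le_one₀ hs0 hs1)
    have h9 : 0 ≤ s.re * N := mul_nonneg hs0 hN0
    linarith
  have := eq_zero_of_antiperiodic_of_bounded_strip hqd hanti hstrip 0
  simpa [hq] using this

/-- An entire function `h` that satisfies `h w = -c e^{⟨w, ν⟩_U} h (D w + ν)`, with `c ≥ 0` and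
`D ≥ 0` diagonal, and that grows at most like a Fock function in the directions where `D = 1`,
vanishes on the slices on which the coordinates in `S` are fixed by `w ↦ D w + ν`. -/
theorem eq_zero_of_functional_equation_of_mem (hU : ∀ i ∈ U, D i = 1) (hU' : ∀ i ∉ U, D i ≠ 1)
    (hD : ∀ i, 0 ≤ D i) (S : Finset (Fin d)) (hS : Disjoint S U)
    {h : (Fin d → ℂ) → ℂ} (hh : Differentiable ℂ h) {c : ℝ} (hc : 0 ≤ c)
    (hfe : ∀ w, h w = -c * Complex.exp (∑ i ∈ U, w i * conj (ν i)) *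
      h (fun i => D i * w i + ν i))
    (hgrowth : ∀ R : ℝ, ∃ C : ℝ, ∀ w : Fin d → ℂ, (∀ i ∉ U, ‖w i‖ ≤ R) →
      ‖h w‖ ≤ C * Real.exp ((∑ i ∈ U, ‖w i‖ ^ 2) / 2))
    {w : Fin d → ℂ} (hw : ∀ i ∉ U, i ∉ S → w i = ν i / (1 - D i)) : h w = 0 := by
  induction S using Finset.induction_on generalizing h c w with
  | empty =>
    exact eq_zero_at_fixed_of_functional_equation hU hU' hh hc hfe hgrowth
      fun i hi => hw i hi (Finset.notMem_empty i)
  | insert j S hj ih =>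
    rw [Finset.disjoint_insert_left] at hS
    obtain ⟨hjU, hS⟩ := hS
    set e : Fin d → ℂ := Pi.single j 1 with he
    have hej : ∀ i ∈ U, e i = 0 := fun i hi => by
      rw [he, Pi.single_eq_of_ne]
      rintro rfl
      exact hjU hi
    -- the derivatives along `e` satisfy the same hypotheses
    have key : ∀ (n : ℕ) {h : (Fin d → ℂ) → ℂ} (_ : Differentiable ℂ h) {c : ℝ} (_ : 0 ≤ c)
        (_ : ∀ w, h w = -c * Complex.exp (∑ i ∈ U, w i * conj (ν i)) *
          h (fun i => D i * w i + ν i))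
        (_ : ∀ R : ℝ, ∃ C : ℝ, ∀ w : Fin d → ℂ, (∀ i ∉ U, ‖w i‖ ≤ R) →
          ‖h w‖ ≤ C * Real.exp ((∑ i ∈ U, ‖w i‖ ^ 2) / 2)) {w : Fin d → ℂ}
        (_ : ∀ i ∉ U, i ∉ S → w i = ν i / (1 - D i)),
        iteratedDeriv n (fun s : ℂ => h (w + s • e)) 0 = 0 := by
      intro n
      induction n with
      | zero =>
        intro h hh c hc hfe hgrowth w hw
        simpa using ih hS hh hc hfe hgrowth hw
      | succ n ihn =>
        intro h hh c hc hfe hgrowth w hw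
        rw [iteratedDeriv_succ']
        have h1 : deriv (fun s : ℂ => h (w + s • e)) =
            fun s => fderiv ℂ h (w + s • e) e := funext fun s => deriv_comp_line hh w e s
        rw [h1]
        refine ihn (differentiable_fderiv_apply hh e) (c := c * D j) (mul_nonneg hc (hD j))
          ?_ ?_ hw
        · intro w
          have h2 := deriv_comp_line hh w e 0
          rw [zero_smul, add_zero] at h2
          rw [← h2]
          have h3 : (fun s : ℂ => h (w + s • e)) = fun s : ℂ =>
              (-c * Complex.exp (∑ i ∈ U, w i * conj (ν i))) *
                h ((fun i => D i * w i + ν i) + s • ((D j : ℂ) • e)) := by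
            ext s
            rw [hfe]
            congr 2
            · congr 1
              refine Finset.sum_congr rfl fun i hi => ?_
              simp [hej i hi]
            · ext i
              by_cases hij : i = j
              · subst hij
                simp [he]
                ring
              · simp [he, hij]
          rw [h3, deriv_const_mul_field, deriv_comp_line hh, zero_smul, add_zero, map_smul,
            smul_eq_mul]
          push_cast
          ring
        · intro R
          obtain ⟨C, hC⟩ := hgrowth (R + 1)
          refine ⟨C, fun w hw => norm_fderiv_apply_le_of_sphere hh w e fun s hs => ?_⟩
          refine (hC _ fun i hi => ?_).trans_eq ?_
          · refine (norm_add_le _ _).trans (add_le_add (hw i hi) ?_)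
            rw [Pi.smul_apply, norm_smul, hs, one_mul, he, Pi.single_apply]
            split_ifs <;> simp
          · congr 3
            refine Finset.sum_congr rfl fun i hi => ?_
            simp [hej i hi]
    set w₀ : Fin d → ℂ := Function.update w j (ν j / (1 - D j)) with hw₀
    have hw₀' : ∀ i ∉ U, i ∉ S → w₀ i = ν i / (1 - D i) := by
      intro i hi hiS
      by_cases hij : i = j
      · subst hij; simp [hw₀]
      · rw [hw₀, Function.update_of_ne hij]
        exact hw i hi (by simp [hij, hiS])
    have hww : w = w₀ + (w j - w₀ j) • e := by
      ext i
      by_cases hij : i = j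
      · subst hij; simp [he]
      · simp [he, hw₀, hij]
    rw [hww]
    exact eq_zero_of_iteratedDeriv_eq_zero (g := fun s : ℂ => h (w₀ + s • e)) (by fun_prop) 0
      (fun n => key n hh hc hfe hgrowth hw₀') _

/-- An entire function with the growth of a Fock function that satisfies
`f w = -c e^{⟨w, ν⟩} f (D w + ν)`, with `c ≥ 0` and `D ≥ 0` diagonal, vanishes. -/
theorem eq_zero_of_functional_equation (hD : ∀ i, 0 ≤ D i) {f : (Fin d → ℂ) → ℂ}
    (hf : Differentiable ℂ f) {c : ℝ} (hc : 0 ≤ c)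
    (hfe : ∀ w, f w = -c * Complex.exp (∑ i, w i * conj (ν i)) * f (fun i => D i * w i + ν i))
    {M : ℝ} (hgrowth : ∀ w : Fin d → ℂ, ‖f w‖ ≤ M * Real.exp ((∑ i, ‖w i‖ ^ 2) / 2)) : f = 0 := by
  classical
  set U : Finset (Fin d) := {i | D i = 1} with hUdef
  have hU : ∀ i ∈ U, D i = 1 := fun i hi => by simpa [hUdef] using hi
  have hU' : ∀ i ∉ U, D i ≠ 1 := fun i hi => by simpa [hUdef] using hi
  set a : Fin d → ℂ := fun i => if i ∈ U then 0 else conj (ν i) / (D i - 1) with ha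
  set h : (Fin d → ℂ) → ℂ := fun w => Complex.exp (∑ i, w i * a i) * f w with hh
  have hhd : Differentiable ℂ h := by fun_prop
  set t : ℝ := ∑ i, if i ∈ U then 0 else ‖ν i‖ ^ 2 / (D i - 1) with ht
  have hhfe : ∀ w, h w = -(c * Real.exp (-t) : ℝ) * Complex.exp (∑ i ∈ U, w i * conj (ν i)) *
      h (fun i => D i * w i + ν i) := by
    intro w
    simp only [hh]
    rw [hfe w]
    have h1 : Complex.exp (∑ i, w i * a i) * Complex.exp (∑ i, w i * conj (ν i)) =
        Complex.exp (-t : ℝ) * Complex.exp (∑ i ∈ U, w i * conj (ν i)) *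
          Complex.exp (∑ i, (D i * w i + ν i) * a i) := by
      rw [← Complex.exp_add, ← Complex.exp_add, ← Complex.exp_add]
      congr 1
      rw [← Finset.sum_add_distrib, ht, ← Finset.sum_ite_mem_eq U, Complex.ofReal_neg,
        Complex.ofReal_sum, ← Finset.sum_neg_distrib, ← Finset.sum_add_distrib,
        ← Finset.sum_add_distrib]
      refine Finset.sum_congr rfl fun i _ => ?_
      by_cases hi : i ∈ U
      · simp [ha, hi]
      · have h2 : (D i - 1 : ℂ) ≠ 0 := by
          rw [sub_ne_zero]
          exact_mod_cast hU' i hi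
        simp only [ha, hi, if_false]
        push_cast
        rw [← Complex.mul_conj']
        field_simp
        ring
    push_cast at h1 ⊢
    linear_combination (-c * f (fun i => D i * w i + ν i)) * h1
  have hhg : ∀ R : ℝ, ∃ C : ℝ, ∀ w : Fin d → ℂ, (∀ i ∉ U, ‖w i‖ ≤ R) →
      ‖h w‖ ≤ C * Real.exp ((∑ i ∈ U, ‖w i‖ ^ 2) / 2) := by
    intro R
    refine ⟨Real.exp (∑ i, R * ‖a i‖) * (|M| * Real.exp ((∑ i ∈ Uᶜ, R ^ 2) / 2)), fun w hw => ?_⟩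
    simp only [hh]
    rw [norm_mul, mul_assoc]
    refine mul_le_mul ?_ ?_ (norm_nonneg _) (Real.exp_nonneg _)
    · rw [Complex.norm_exp]
      gcongr
      refine (Complex.re_le_norm _).trans ((norm_sum_le _ _).trans (Finset.sum_le_sum fun i _ => ?_))
      by_cases hi : i ∈ U
      · simp [ha, hi]
      · rw [norm_mul]
        gcongr
        exact hw i hi
    · refine (hgrowth w).trans ?_
      rw [mul_assoc, ← Real.exp_add, ← add_div, ← Finset.sum_compl_add_sum U]
      refine mul_le_mul (le_abs_self M) ?_ (Real.exp_nonneg _) (abs_nonneg _)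
      gcongr with i hi
      exact hw i (by simpa using hi)
  ext w
  have := eq_zero_of_functional_equation_of_mem hU hU' hD Uᶜ disjoint_compl_left hhd
    (mul_nonneg hc (Real.exp_nonneg _)) hhfe hhg (w := w)
    (fun i hi hi' => absurd (Finset.mem_compl.2 hi) hi')
  simpa [hh] using this

end FunctionalEquation

namespace FockSpace

open ComplexConjugate

variable {d : ℕ}

theorem integrable_gaussian :
    Integrable fun z : Fin d → ℂ => Real.exp (-∑ i, ‖z i‖ ^ 2) := by
  have h1 : Integrable fun z : ℂ => Real.exp (-‖z‖ ^ 2) := by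
    have h := (GaussianFourier.integrable_cexp_neg_mul_sq_norm_add (b := 1) (by simp) 0 (0 : ℂ)).re
    refine h.congr (ae_of_all _ fun z => ?_)
    simp only [zero_mul, add_zero, neg_mul, one_mul]
    rw [← Complex.ofReal_pow, ← Complex.ofReal_neg, ← Complex.ofReal_exp]
    rfl
  have h2 := Integrable.fintype_prod (ι := Fin d) (f := fun _ => fun z : ℂ => Real.exp (-‖z‖ ^ 2))
    (μ := fun _ => volume) fun _ => h1
  refine h2.congr (ae_of_all _ fun z => ?_)
  simp only
  rw [← Real.exp_sum, Finset.sum_neg_distrib]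

theorem integral_gaussian_eq :
    ∫ z : Fin d → ℂ, Real.exp (-∑ i, ‖z i‖ ^ 2) = Real.pi ^ d := by
  have h1 : ∫ z : ℂ, Real.exp (-‖z‖ ^ 2) = Real.pi := by
    have := GaussianFourier.integral_rexp_neg_mul_sq_norm (V := ℂ) one_pos
    simpa [Complex.finrank_real_complex] using this
  have h2 := integral_fintype_prod_volume_eq_pow (ι := Fin d) (fun z : ℂ => Real.exp (-‖z‖ ^ 2))
  rw [h1, Fintype.card_fin] at h2
  rw [← h2]
  refine integral_congr_ae (ae_of_all _ fun z => ?_)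
  simp only
  rw [← Real.exp_sum, Finset.sum_neg_distrib]

theorem sum_norm_sub_sq (z w : Fin d → ℂ) :
    ∑ i, ‖z i - w i‖ ^ 2 = ∑ i, ‖z i‖ ^ 2 + ∑ i, ‖w i‖ ^ 2 - 2 * (cInner z w).re := by
  rw [cInner, Complex.re_sum, Finset.mul_sum, ← Finset.sum_add_distrib, ← Finset.sum_sub_distrib]
  refine Finset.sum_congr rfl fun i _ => ?_
  simp only [← Complex.normSq_eq_norm_sq, Complex.normSq_apply]
  simp
  ring

theorem integrable_fockMeasure_iff {g : (Fin d → ℂ) → ℂ} :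
    Integrable g (fockMeasure d) ↔
      Integrable fun z => g z * (Real.exp (-∑ i, ‖z i‖ ^ 2) : ℝ) := by
  rw [fockMeasure, integrable_withDensity_iff_integrable_smul₀' measurable_density.aemeasurable
    (ae_of_all _ fun z => ENNReal.ofReal_lt_top)]
  have hp : (((Real.pi ^ d)⁻¹ : ℝ) : ℂ) ≠ 0 := by
    simp [Real.pi_ne_zero]
  rw [← integrable_const_mul_iff (isUnit_iff_ne_zero.2 hp)
    (fun z => g z * (Real.exp (-∑ i, ‖z i‖ ^ 2) : ℝ))]
  refine integrable_congr (ae_of_all _ fun z => ?_)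
  have : 0 ≤ (Real.pi ^ d)⁻¹ * Real.exp (-∑ i, ‖z i‖ ^ 2) := by positivity
  simp only [ENNReal.toReal_ofReal this, Complex.real_smul]
  push_cast
  ring

theorem differentiable_cInner (w : Fin d → ℂ) : Differentiable ℂ fun z => cInner z w := by
  unfold cInner
  fun_prop

theorem memLp_exp_cInner (w : Fin d → ℂ) :
    MemLp (fun z => Complex.exp (cInner z w)) 2 (fockMeasure d) := by
  have hc : Continuous fun z : Fin d → ℂ => Complex.exp (cInner z w) :=
    (differentiable_cInner w).continuous.cexp
  rw [memLp_two_iff_integrable_sq_norm hc.aestronglyMeasurable]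
  suffices h : Integrable (fun z => ((‖Complex.exp (cInner z w)‖ ^ 2 : ℝ) : ℂ)) (fockMeasure d) from
    h.re
  rw [integrable_fockMeasure_iff]
  have h1 := ((integrable_gaussian (d := d)).comp_sub_right w).const_mul
    (Real.exp (∑ i, ‖w i‖ ^ 2))
  refine h1.ofReal.congr (ae_of_all _ fun z => ?_)
  simp only [Pi.sub_apply]
  rw [sum_norm_sub_sq, Complex.norm_exp, ← Real.exp_nat_mul, ← Real.exp_add]
  rw [← Complex.ofReal_mul, ← Real.exp_add]
  congr 2
  push_cast
  ring

/-- The reproducing kernel `K_w(z) = e^{⟨z, w⟩}` of the Fock space. -/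
noncomputable def kernel (w : Fin d → ℂ) : FockSpace d :=
  ⟨fun z => Complex.exp (cInner z w), (differentiable_cInner w).cexp, memLp_exp_cInner w⟩

theorem kernel_apply (w z : Fin d → ℂ) : kernel w z = Complex.exp (cInner z w) := rfl

/-- The mean value property for the Gaussian measure. -/
theorem integral_mul_gaussian_eq {g : (Fin d → ℂ) → ℂ} (hg : Differentiable ℂ g)
    (hint : Integrable fun z => g z * (Real.exp (-∑ i, ‖z i‖ ^ 2) : ℝ)) :
    ∫ z, g z * (Real.exp (-∑ i, ‖z i‖ ^ 2) : ℝ) = Real.pi ^ d * g 0 := by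
  set G : (Fin d → ℂ) → ℝ := fun z => Real.exp (-∑ i, ‖z i‖ ^ 2) with hG
  set e : ℝ → (Fin d → ℂ) ≃ᵐ (Fin d → ℂ) := fun t => MeasurableEquiv.piCongrRight
    fun _ => (rotation (Circle.exp t)).toHomeomorph.toMeasurableEquiv with he
  have hmp : ∀ t, MeasurePreserving (e t) := fun t => rotate_measurePreserving t
  have hez : ∀ t z, e t z = Complex.exp (t * Complex.I) • z := by
    intro t z
    ext i
    change rotation (Circle.exp t) (z i) = _
    simp [rotation_apply]
  have hGe : ∀ (t : ℝ) z, G (Complex.exp (t * Complex.I) • z) = G z := by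
    intro t z
    simp [hG, Complex.norm_exp_ofReal_mul_I]
  have hrot : ∀ t : ℝ, ∫ z, g (Complex.exp (t * Complex.I) • z) * G z = ∫ z, g z * G z := by
    intro t
    rw [← (hmp t).integral_comp (e t).measurableEmbedding (fun z => g z * G z)]
    simp only [hez, hGe]
  have hcirc : ∀ z : Fin d → ℂ,
      ∫ t in (0 : ℝ)..2 * Real.pi, g (Complex.exp (t * Complex.I) • z) * G z
        = (2 * Real.pi : ℝ) • (g 0 * G z) := by
    intro z
    have hd : Differentiable ℂ fun w : ℂ => g (w • z) := by fun_prop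
    have := hd.diffContOnCl.circleAverage (c := 0) (R := 1)
    rw [Real.circleAverage_def] at this
    simp only [circleMap, zero_add, Complex.ofReal_one, one_mul, zero_smul] at this
    rw [intervalIntegral.integral_mul_const, ← this, ← smul_mul_assoc, smul_smul,
      mul_inv_cancel₀ (by positivity), one_smul]
  have hcont : Continuous (Function.uncurry fun (t : ℝ) (z : Fin d → ℂ) =>
      g (Complex.exp (t * Complex.I) • z) * G z) := by
    have := hg.continuous
    fun_prop
  have hswap := intervalIntegral_integral_swap (a := 0) (b := 2 * Real.pi)
    (μ := (volume : Measure (Fin d → ℂ)))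
    (f := fun (t : ℝ) (z : Fin d → ℂ) => g (Complex.exp (t * Complex.I) • z) * G z) (by
      rw [integrable_prod_iff hcont.aestronglyMeasurable]
      have hn : ∀ t : ℝ, ∫ z, ‖g (Complex.exp (t * Complex.I) • z) * G z‖ = ∫ z, ‖g z * G z‖ := by
        intro t
        rw [← (hmp t).integral_comp (e t).measurableEmbedding (fun z => ‖g z * G z‖)]
        simp only [hez, hGe]
      refine ⟨ae_of_all _ fun t => ?_, ?_⟩
      · have := (hmp t).integrable_comp_of_integrable hint
        refine this.congr (ae_of_all _ fun z => ?_)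
        simp only [Function.comp, hez]
        rw [show Real.exp (-∑ i, ‖(Complex.exp (t * Complex.I) • z) i‖ ^ 2) = G z from hGe t z]
        rfl
      · simp only [Function.uncurry, hn]
        exact continuous_const.integrableOn_uIoc)
  simp only [hrot, hcirc] at hswap
  rw [intervalIntegral.integral_const, sub_zero, integral_smul] at hswap
  have h := smul_right_injective ℂ (by positivity : (2 * Real.pi : ℝ) ≠ 0) hswap
  rw [h, integral_const_mul, integral_complex_ofReal, integral_gaussian_eq]
  push_cast
  ring

theorem inner_kernel (f : FockSpace d) (w : Fin d → ℂ) : inner ℂ (kernel w) f = f w := by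
  rw [inner_eq]
  have hprod : Integrable (fun z => f z * conj (kernel w z)) (fockMeasure d) :=
    MemLp.integrable_mul f.memLp (kernel w).memLp.star
  rw [integrable_fockMeasure_iff] at hprod
  have hpt : ∀ z : Fin d → ℂ, f (z + w) * conj (kernel w (z + w)) *
      (Real.exp (-∑ i, ‖(z + w) i‖ ^ 2) : ℝ) =
      f (z + w) * Complex.exp (-cInner z w) * (Real.exp (-∑ i, ‖z i‖ ^ 2) : ℝ) := by
    intro z
    rw [kernel_apply, ← Complex.exp_conj, mul_assoc, mul_assoc, Complex.ofReal_exp,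
      Complex.ofReal_exp, ← Complex.exp_add, ← Complex.exp_add]
    congr 2
    push_cast
    simp only [cInner, map_sum, ← Finset.sum_neg_distrib, ← Finset.sum_add_distrib]
    refine Finset.sum_congr rfl fun i _ => ?_
    rw [← Complex.mul_conj', ← Complex.mul_conj']
    simp only [Pi.add_apply, map_add, map_mul, Complex.conj_conj]
    ring
  have h1 := integral_mul_gaussian_eq (g := fun z => f (z + w) * Complex.exp (-cInner z w)) (by
    have := f.differentiable
    have := differentiable_cInner w
    fun_prop) ((hprod.comp_add_right w).congr (ae_of_all _ hpt))
  rw [← integral_add_right_eq_self _ w]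
  simp only [hpt]
  rw [h1, Complex.real_smul]
  have hp : (Real.pi : ℂ) ≠ 0 := by simp [Real.pi_ne_zero]
  have h0 : cInner 0 w = 0 := by simp [cInner]
  push_cast
  rw [zero_add, h0, neg_zero, Complex.exp_zero, mul_one]
  field_simp

theorem norm_kernel_sq (w : Fin d → ℂ) : ‖kernel w‖ ^ 2 = Real.exp (∑ i, ‖w i‖ ^ 2) := by
  have h := inner_kernel (kernel w) w
  rw [inner_self_eq_norm_sq_to_K, kernel_apply] at h
  have h1 : cInner w w = ((∑ i, ‖w i‖ ^ 2 : ℝ) : ℂ) := by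
    push_cast
    exact Finset.sum_congr rfl fun i _ => Complex.mul_conj' _
  rw [h1, ← Complex.ofReal_exp] at h
  change ((‖kernel w‖ : ℝ) : ℂ) ^ 2 = _ at h
  exact_mod_cast h

/-- The pointwise growth of the functions of the Fock space. -/
theorem norm_apply_le (f : FockSpace d) (w : Fin d → ℂ) :
    ‖f w‖ ≤ ‖f‖ * Real.exp ((∑ i, ‖w i‖ ^ 2) / 2) := by
  have h1 : ‖kernel w‖ = Real.exp ((∑ i, ‖w i‖ ^ 2) / 2) := by
    rw [← sq_eq_sq₀ (norm_nonneg _) (Real.exp_nonneg _), norm_kernel_sq, ← Real.exp_nat_mul]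
    congr 1
    push_cast
    ring
  rw [← inner_kernel f w, ← h1, mul_comm]
  exact norm_inner_le_norm _ _

theorem continuous_eval (w : Fin d → ℂ) : Continuous fun f : FockSpace d => f w := by
  simp only [← inner_kernel]
  fun_prop

theorem dense_span_kernel :
    Dense (Submodule.span ℂ (Set.range (kernel (d := d))) : Set (FockSpace d)) := by
  rw [Submodule.dense_iff_topologicalClosure_eq_top,
    Submodule.topologicalClosure_eq_top_iff, Submodule.eq_bot_iff]
  intro f hf
  apply toFun_injective
  ext w
  rw [← inner_kernel]
  simpa using (Submodule.mem_orthogonal _ _).1 hf _ (Submodule.subset_span ⟨w, rfl⟩)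

end FockSpace

section WeightedComposition

open ComplexConjugate FockSpace

variable {d : ℕ}

theorem mem_maxWeightedComp_domain {ψ : (Fin d → ℂ) → ℂ} {φ : (Fin d → ℂ) → Fin d → ℂ}
    {f g : FockSpace d} (h : ∀ z, g z = ψ z * f (φ z)) :
    f ∈ (maxWeightedComp ψ φ).domain := by
  change weightedComp ψ φ f ∈ fockSubmodule d
  rw [show weightedComp ψ φ f = g from funext fun z => (h z).symm]
  exact g.2

theorem maxWeightedComp_apply {ψ : (Fin d → ℂ) → ℂ} {φ : (Fin d → ℂ) → Fin d → ℂ}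
    (f : (maxWeightedComp ψ φ).domain) (z : Fin d → ℂ) :
    maxWeightedComp ψ φ f z = ψ z * (f : FockSpace d) (φ z) := rfl

theorem mem_graph_maxWeightedComp_iff {ψ : (Fin d → ℂ) → ℂ} {φ : (Fin d → ℂ) → Fin d → ℂ}
    {p : FockSpace d × FockSpace d} :
    p ∈ (maxWeightedComp ψ φ).graph ↔ ∀ z, p.2 z = ψ z * p.1 (φ z) := by
  rw [LinearPMap.mem_graph_iff]
  constructor
  · rintro ⟨f, hf, hf'⟩ z
    rw [← hf, ← hf']
    rfl
  · intro h
    exact ⟨⟨p.1, mem_maxWeightedComp_domain h⟩, rfl, toFun_injective (funext fun z => (h z).symm)⟩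

theorem isClosed_graph_maxWeightedComp (ψ : (Fin d → ℂ) → ℂ) (φ : (Fin d → ℂ) → Fin d → ℂ) :
    IsClosed ((maxWeightedComp ψ φ).graph : Set (FockSpace d × FockSpace d)) := by
  have : ((maxWeightedComp ψ φ).graph : Set (FockSpace d × FockSpace d)) =
      ⋂ z, {p | p.2 z = ψ z * p.1 (φ z)} := by
    ext p
    simp only [SetLike.mem_coe, mem_graph_maxWeightedComp_iff, Set.mem_iInter, Set.mem_ofPred_eq]
  rw [this]
  exact isClosed_iInter fun z => isClosed_eq ((continuous_eval z).comp continuous_snd)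
    (continuous_const.mul ((continuous_eval (φ z)).comp continuous_fst))

/-- If no nonzero vector of the graph of a closed operator `T` is orthogonal to all the graph
vectors `(u i, v i)`, then `⟨x, T f⟩ = ⟨y, f⟩` holds on the whole domain as soon as it holds on
the `u i`. -/
theorem inner_eq_of_graph_orthogonal {H ι : Type*} [NormedAddCommGroup H]
    [InnerProductSpace ℂ H] [CompleteSpace H] {T : H →ₗ.[ℂ] H} (hT : T.IsClosed) {u v : ι → H}
    (huv : ∀ i, (u i, v i) ∈ T.graph)
    (hker : ∀ p ∈ T.graph, (∀ i, inner ℂ (u i) p.1 + inner ℂ (v i) p.2 = 0) → p = 0)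
    {x y : H} (hxy : ∀ i, inner ℂ x (v i) = inner ℂ y (u i)) (f : T.domain) :
    inner ℂ x (T f) = inner ℂ y (f : H) := by
  set L := WithLp.linearEquiv 2 ℂ (H × H) with hL
  have hLc : Continuous L := WithLp.prod_continuous_ofLp 2 H H
  set N : Submodule ℂ (WithLp 2 (H × H)) :=
    (Submodule.span ℂ (Set.range fun i => L.symm (u i, v i))).topologicalClosure with hN
  have hNs : ∀ P : Submodule ℂ (WithLp 2 (H × H)), IsClosed (P : Set (WithLp 2 (H × H))) →
      (∀ i, L.symm (u i, v i) ∈ P) → N ≤ P := by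
    intro P hP h
    refine Submodule.topologicalClosure_minimal _ (Submodule.span_le.2 ?_) hP
    rintro _ ⟨i, rfl⟩
    exact h i
  have hmem : ∀ i, L.symm (u i, v i) ∈ N := fun i =>
    Submodule.le_topologicalClosure _ (Submodule.subset_span ⟨i, rfl⟩)
  have hNT : N ≤ T.graph.comap L.toLinearMap :=
    hNs _ (hT.preimage hLc) fun i => by simpa using huv i
  have : CompleteSpace N := (Submodule.isClosed_topologicalClosure _).completeSpace_coe
  set p := L.symm ((f : H), T f) with hp
  have hpN : p ∈ N := by
    have h1 : p - N.starProjection p ∈ Nᗮ := N.sub_starProjection_mem_orthogonal p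
    have h2 : p - N.starProjection p ∈ T.graph.comap L.toLinearMap := by
      refine Submodule.sub_mem _ ?_ (hNT (N.starProjection_apply_mem p))
      simp [hp]
    have h3 := hker (L (p - N.starProjection p)) h2 fun i => by
      have := (Submodule.mem_orthogonal _ _).1 h1 _ (hmem i)
      rwa [WithLp.prod_inner_apply] at this
    rw [LinearEquiv.map_eq_zero_iff, sub_eq_zero] at h3
    rw [h3]
    exact N.starProjection_apply_mem p
  set B : WithLp 2 (H × H) →ₗ[ℂ] ℂ :=
    ((innerₛₗ ℂ x).comp (LinearMap.snd ℂ H H) - (innerₛₗ ℂ y).comp (LinearMap.fst ℂ H H)).comp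
      L.toLinearMap with hB
  have hBc : Continuous B := by
    have h1 : Continuous fun q : H × H => inner ℂ x q.2 - inner ℂ y q.1 := by fun_prop
    exact h1.comp hLc
  have h4 : N ≤ LinearMap.ker B := hNs _ (isClosed_singleton.preimage hBc) fun i => by
    simp [hB, hxy]
  have h5 : B p = 0 := h4 hpN
  simpa [hB, hp, sub_eq_zero] using h5

/-- The action of a weighted composition operator with affine symbol on the kernels. -/
theorem exp_mul_kernel (a β lam w z : Fin d → ℂ) (θ : ℂ) :
    θ * Complex.exp (cInner z (star lam)) * kernel w (fun i => a i * z i + β i) =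
      θ * Complex.exp (cInner β w) * kernel (fun i => conj (a i) * w i + conj (lam i)) z := by
  simp only [kernel_apply, mul_assoc, ← Complex.exp_add]
  congr 2
  simp only [cInner, ← Finset.sum_add_distrib]
  refine Finset.sum_congr rfl fun i _ => ?_
  simp only [Pi.star_apply, map_add, map_mul, Complex.conj_conj, RCLike.star_def]
  ring

theorem kernel_mem_graph (a β lam w : Fin d → ℂ) (θ : ℂ) :
    (kernel w, (θ * Complex.exp (cInner β w)) •
        kernel (fun i => conj (a i) * w i + conj (lam i))) ∈
      (maxWeightedComp (fun z => θ * Complex.exp (cInner z (star lam)))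
        (fun z i => a i * z i + β i)).graph := by
  rw [mem_graph_maxWeightedComp_iff]
  intro z
  rw [exp_mul_kernel]
  rfl

theorem conj_exp_cInner (β w : Fin d → ℂ) :
    conj (Complex.exp (cInner β w)) = Complex.exp (cInner w β) := by
  rw [← Complex.exp_conj]
  congr 1
  simp only [cInner, map_sum, map_mul, Complex.conj_conj]
  exact Finset.sum_congr rfl fun i _ => mul_comm _ _

theorem inner_exp_smul_kernel (a β lam w : Fin d → ℂ) (θ : ℂ) (f : FockSpace d) :
    inner ℂ ((θ * Complex.exp (cInner β w)) •
        kernel (fun i => conj (a i) * w i + conj (lam i))) f =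
      conj θ * Complex.exp (cInner w β) * f (fun i => conj (a i) * w i + conj (lam i)) := by
  rw [inner_smul_left, inner_kernel, map_mul, conj_exp_cInner]

theorem dense_domain_maxWeightedComp (a β lam : Fin d → ℂ) (θ : ℂ) :
    Dense ((maxWeightedComp (fun z => θ * Complex.exp (cInner z (star lam)))
        (fun z i => a i * z i + β i)).domain : Set (FockSpace d)) := by
  refine dense_span_kernel.mono (Submodule.span_le.2 ?_)
  rintro _ ⟨w, rfl⟩
  exact LinearPMap.mem_domain_of_mem_graph (kernel_mem_graph a β lam w θ)

/-- The kernels form a core of a weighted composition operator with affine diagonal symbol. -/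
theorem eq_zero_of_orthogonal_kernel_graph (a β lam : Fin d → ℂ) (θ : ℂ)
    {p : FockSpace d × FockSpace d}
    (hp : p ∈ (maxWeightedComp (fun z => θ * Complex.exp (cInner z (star lam)))
        (fun z i => a i * z i + β i)).graph)
    (horth : ∀ w, inner ℂ (kernel w) p.1 + inner ℂ ((θ * Complex.exp (cInner β w)) •
        kernel (fun i => conj (a i) * w i + conj (lam i))) p.2 = 0) : p = 0 := by
  rw [mem_graph_maxWeightedComp_iff] at hp
  have h1 : (p.1 : (Fin d → ℂ) → ℂ) = 0 := by
    refine eq_zero_of_functional_equation (D := fun i => ‖a i‖ ^ 2)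
      (ν := fun i => a i * conj (lam i) + β i) (c := ‖θ‖ ^ 2 * Real.exp (∑ i, ‖lam i‖ ^ 2))
      (fun i => by positivity) p.1.differentiable (by positivity) (fun w => ?_)
      (norm_apply_le p.1)
    have h := horth w
    rw [inner_kernel, inner_exp_smul_kernel, hp] at h
    have harg : (fun i => a i * (conj (a i) * w i + conj (lam i)) + β i) =
        fun i => ((‖a i‖ ^ 2 : ℝ) : ℂ) * w i + (a i * conj (lam i) + β i) := by
      ext i
      push_cast
      rw [← Complex.mul_conj']
      ring
    have hexp : Complex.exp (cInner w β) *
        Complex.exp (cInner (fun i => conj (a i) * w i + conj (lam i)) (star lam)) =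
        Complex.exp ((∑ i, ‖lam i‖ ^ 2 : ℝ) : ℂ) *
          Complex.exp (∑ i, w i * conj (a i * conj (lam i) + β i)) := by
      rw [← Complex.exp_add, ← Complex.exp_add]
      congr 1
      push_cast
      simp only [cInner, ← Finset.sum_add_distrib]
      refine Finset.sum_congr rfl fun i _ => ?_
      rw [← Complex.mul_conj']
      simp only [Pi.star_apply, map_add, map_mul, Complex.conj_conj, RCLike.star_def]
      ring
    rw [harg] at h
    have hθ : conj θ * θ = (‖θ‖ : ℂ) ^ 2 := Complex.conj_mul' θ
    rw [Complex.ofReal_mul, Complex.ofReal_exp, Complex.ofReal_pow, ← hθ]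
    linear_combination h - (conj θ * θ *
      p.1 (fun i => ((‖a i‖ ^ 2 : ℝ) : ℂ) * w i + (a i * conj (lam i) + β i))) * hexp
  have h2 : (p.2 : (Fin d → ℂ) → ℂ) = 0 := by
    ext z
    rw [hp, h1]
    simp
  exact Prod.ext (toFun_injective (h1.trans (map_zero _).symm))
    (toFun_injective (h2.trans (map_zero _).symm))

theorem adjoint_maxWeightedComp_diagonal (a β lam : Fin d → ℂ) (θ : ℂ) :
    (maxWeightedComp (fun z => θ * Complex.exp (cInner z (star lam)))
        (fun z i => a i * z i + β i)).adjoint =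
      maxWeightedComp (fun z => star θ * Complex.exp (cInner z β))
        (fun z i => conj (a i) * z i + conj (lam i)) := by
  set T := maxWeightedComp (fun z => θ * Complex.exp (cInner z (star lam)))
        (fun z i => a i * z i + β i) with hT
  have hdense : Dense (T.domain : Set (FockSpace d)) := dense_domain_maxWeightedComp a β lam θ
  refine le_antisymm (LinearPMap.le_of_le_graph ?_) (LinearPMap.IsFormalAdjoint.le_adjoint hdense ?_)
  · intro p hp
    rw [LinearPMap.mem_graph_iff] at hp
    obtain ⟨g, hg, hg'⟩ := hp
    rw [mem_graph_maxWeightedComp_iff]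
    intro w
    obtain ⟨k, hk, hk'⟩ := LinearPMap.mem_graph_iff _ |>.1 (kernel_mem_graph a β lam w θ)
    have h := LinearPMap.adjoint_isFormalAdjoint hdense g k
    rw [hg, hg', hk, hk', ← inner_conj_symm, inner_kernel, ← inner_conj_symm,
      inner_exp_smul_kernel] at h
    exact (starRingEnd ℂ).injective h
  · refine LinearPMap.IsFormalAdjoint.symm fun g f => ?_
    refine (inner_eq_of_graph_orthogonal
      (u := kernel) (isClosed_graph_maxWeightedComp _ _) (fun w => kernel_mem_graph a β lam w θ)
      (fun p hp => eq_zero_of_orthogonal_kernel_graph a β lam θ hp) (fun w => ?_) f).symm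
    rw [← inner_conj_symm, inner_exp_smul_kernel, ← inner_conj_symm, inner_kernel,
      maxWeightedComp_apply]
    rfl

end WeightedComposition

theorem proposition2p1 (d : ℕ) (A : Matrix (Fin d) (Fin d) ℂ) (hA : A.IsDiag)
    (β lam : Fin d → ℂ) (θ : ℂ) :
    Dense ((maxWeightedComp (fun z => θ * Complex.exp (cInner z (star lam)))
        (fun z => A.mulVec z + β)).domain : Set (FockSpace d)) ∧
      (maxWeightedComp (fun z => θ * Complex.exp (cInner z (star lam)))
        (fun z => A.mulVec z + β)).adjoint =
      maxWeightedComp (fun z => star θ * Complex.exp (cInner z β))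
        (fun z => (A.map star).mulVec z + star lam) := by
  obtain ⟨a, rfl⟩ : ∃ a, A = Matrix.diagonal a := ⟨A.diag, hA.diagonal_diag.symm⟩
  have h1 : (fun z => (Matrix.diagonal a).mulVec z + β) = fun z i => a i * z i + β i := by
    ext z i
    simp [Matrix.mulVec_diagonal]
  have h2 : (fun z => ((Matrix.diagonal a).map star).mulVec z + star lam) =
      fun z i => (starRingEnd ℂ) (a i) * z i + (starRingEnd ℂ) (lam i) := by
    ext z i
    simp [Matrix.diagonal_map, Matrix.mulVec_diagonal]
  rw [h1, h2]
  exact ⟨dense_domain_maxWeightedComp a β lam θ, adjoint_maxWeightedComp_diagonal a β lam θ⟩
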